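/- Let $(\mathbb T,\tau)$ be a compact metric space and $X=\{X_t,\ t\in\mathbb T\}$ a centered real Gaussian process with almost surely continuous paths on a probability space $(\Omega,\mathcal F,\mathbf P)$, with covariance function $R(t,s)=\mathbf E[X_tX_s]$. Put $\mathbb T_0=\{t\in\mathbb T: X_t=0 \text{ a.s.}\}$, $\mathbb T_1=\mathbb T\setminus\mathbb T_0$, and let $M(\mathbb T_1)$ (resp. $M^+(\mathbb T_1)$) be the set of finite signed (resp. finite non-negative) Borel measures on $\mathbb T_1$. For $\mu,\nu\in M(\mathbb T_1)$ let $$\mathcal R\mu(t)=\int_{\mathbb T_1}R(t,s)\,\mu(ds)\quad(t\in\mathbb T),\qquad (\mu,\nu)_{\mathcal H_X}=\int_{\mathbb T_1}\mathcal R\mu\,d\nu,\qquad \|\mu\|_{\mathcal H_X}^2=(\mu,\mu)_{\mathcal H_X}.$$ Let $\mathbb H_X$ be the reproducing kernel Hilbert space of $X$, i.e. the Hilbert space of functions on $\mathbb T$ with reproducing kernel $R$. For $f,u\colon\mathbb T\to\mathbb R$ let $$P_{f,u}=\mathbf P\big(\forall t\in\mathbb T:\ X_t+f(t)\le u(t)\big),\qquad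 \Theta(\mu,u)=\int_{\mathbb T_1}u\,d\mu .$$ **Theorem.** Assume that * (D) $\mathcal R$ is injective on $M(\mathbb T_1)$; * $f\in\mathbb H_X$, and $u\colon\mathbb T\to\mathbb R$ is lower semicontinuous; * (U) there is a sequence $(u_n)_{n\ge1}$ of continuous functions on $\mathbb T$ such that $u_n(t)\uparrow u(t)$ as $n\to\infty$ for every $t\in\mathbb T_1$, and $\mathbf P(\forall t\in\mathbb T:\ u_n(t)\le X_t\le u(t))>0$ for every $n\ge1$. Suppose that $\tilde f=\mathcal R\tilde\gamma$ satisfies * (G1) $\tilde\gamma\in M^+(\mathbb T_1)$; * (G2) $\int_{\mathbb T_1}(f-\tilde f)\,d\tilde\gamma\ge0$; * (G3) $\tilde f(t)\ge f(t)$ for all $t\in\mathbb T$; and that $u$ is $\tilde\gamma$-integrable, i.e. $\Theta(\tilde\gamma,u)$ is finite. Then $P_{cf,u}>0$ for all sufficiently large $c$, and $$\log P_{cf,u}=-\frac{c^2}{2}\|\tilde\gamma\|_{\mathcal H_X}^2+c\,\Theta(\tilde\gamma,u)+o(c),\qquad c\to+\infty .$$ -/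

import Mathlib

open MeasureTheory ProbabilityTheory Filter Topology
open scoped Asymptotics

namespace NonCrossing

noncomputable section

variable {T Ω : Type*} [MeasurableSpace Ω]

/-- The covariance function `R(t, s) = E[X_t X_s]` of a centered process. -/
def covFun (X : T → Ω → ℝ) (P : Measure Ω) (t s : T) : ℝ := ∫ ω, X t ω * X s ω ∂P

/-- The zero set `T₀` of the process. -/
def zeroSet (X : T → Ω → ℝ) (P : Measure Ω) : Set T := {t | ∀ᵐ ω ∂P, X t ω = 0}

/-- The complement `T₁ = T \ T₀` of the zero set, as a type. The space `M(T₁)` is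
`SignedMeasure (NonzeroSet X P)`. -/
abbrev NonzeroSet (X : T → Ω → ℝ) (P : Measure Ω) : Type _ := ((zeroSet X P)ᶜ : Set T)

/-- The covariance operator `(ℛ μ)(t) = ∫_{T₁} R(t, s) μ(ds)` on `M(T₁)`. -/
def covOp [MeasurableSpace T] (X : T → Ω → ℝ) (P : Measure Ω)
    (μ : SignedMeasure (NonzeroSet X P)) (t : T) : ℝ :=
  μ.integral (fun s : NonzeroSet X P => covFun X P t s) (ContinuousLinearMap.lsmul ℝ ℝ).flip

/-- The duality pairing `⟨x, μ⟩ = ∫_{T₁} x(t) μ(dt)` of a function on `T` with `μ ∈ M(T₁)`. -/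
def pairing [MeasurableSpace T] (X : T → Ω → ℝ) (P : Measure Ω)
    (x : T → ℝ) (μ : SignedMeasure (NonzeroSet X P)) : ℝ :=
  μ.integral (fun t : NonzeroSet X P => x t) (ContinuousLinearMap.lsmul ℝ ℝ).flip

/-- The inner product `⟨ℛ μ, ν⟩` on `M(T₁)`. The Hilbert space `ℋ_X` is the completion of
(the quotient by `ker ℛ` of) `M(T₁)` with respect to it. -/
def innerHX [MeasurableSpace T] (X : T → Ω → ℝ) (P : Measure Ω)
    (μ ν : SignedMeasure (NonzeroSet X P)) : ℝ :=
  pairing X P (covOp X P μ) ν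

/-- The norm in `ℋ_X` of an element of `M(T₁)`. -/
def normHX [MeasurableSpace T] (X : T → Ω → ℝ) (P : Measure Ω)
    (μ : SignedMeasure (NonzeroSet X P)) : ℝ :=
  Real.sqrt (innerHX X P μ μ)

/-- The covariance function as a (scalar) operator-valued kernel, which is the form in which
Mathlib's reproducing kernel Hilbert spaces take their kernel. -/
def covKernel (X : T → Ω → ℝ) (P : Measure Ω) : Matrix T T (ℝ →L[ℝ] ℝ) :=
  Matrix.of fun t s => covFun X P t s • ContinuousLinearMap.id ℝ ℝ

theorem covKernel_posSemidef {X : T → Ω → ℝ} {P : Measure Ω} (hX : IsGaussianProcess X P) :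
    (covKernel X P).PosSemidef := by
  have hL : ∀ t, MemLp (X t) 2 P := fun t => (hX.hasGaussianLaw_eval t).memLp_two
  have h := (RKHS.posSemidef_tfae (K := covKernel X P)).out 0 2
  refine h.mpr ⟨?_, fun v => ?_⟩
  · ext t s
    simp [covKernel, covFun, mul_comm, ContinuousLinearMap.star_eq_adjoint,
      ContinuousLinearMap.adjoint_id]
  · have key : (v.sum fun x w => v.sum fun x' w' =>
        inner ℝ ((covKernel X P) x' x w) w') = ∫ ω, (v.sum fun x w => w * X x ω) ^ 2 ∂P := by
      have hint : ∀ x y : T, ∀ a b : ℝ, Integrable (fun ω => a * X x ω * (b * X y ω)) P :=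
        fun x y a b => ((hL x).const_mul a).integrable_mul ((hL y).const_mul b)
      simp only [Finsupp.sum, sq, Finset.sum_mul_sum]
      rw [integral_finsetSum _ fun x _ => integrable_finsetSum _ fun y _ => hint x y _ _]
      refine Finset.sum_congr rfl fun x _ => ?_
      rw [integral_finsetSum _ fun y _ => hint x y _ _]
      refine Finset.sum_congr rfl fun y _ => ?_
      have : (fun ω => v x * X x ω * (v y * X y ω)) =
          fun ω => (v x * v y) * (X y ω * X x ω) := by
        funext ω; ring
      rw [this, integral_const_mul]
      simp [covKernel, covFun]
      ring
    rw [key]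
    exact integral_nonneg fun ω => sq_nonneg _

/-- The reproducing kernel Hilbert space (Cameron--Martin space) `ℍ_X` of the process: the linear
space of the functions on `T` that are the elements of the completion of the span of the
`R(t, ·)` with respect to the inner product with `(R(t, ·), R(s, ·)) = R(t, s)`. -/
def rkhs {X : T → Ω → ℝ} {P : Measure Ω} (hX : IsGaussianProcess X P) : Submodule ℝ (T → ℝ) :=
  haveI : Fact (covKernel X P).PosSemidef := ⟨covKernel_posSemidef hX⟩
  LinearMap.range (RKHS.coeCLM ℝ : RKHS.OfKernel (covKernel X P) →L[ℝ] T → ℝ).toLinearMap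

/-- The boundary non-crossing probability `P_{f,u} = P(∀ t, X_t + f(t) ≤ u(t))`. -/
def nonCrossProb (X : T → Ω → ℝ) (P : Measure Ω) (f u : T → ℝ) : ℝ :=
  P.real {ω | ∀ t, X t ω + f t ≤ u t}

/-- The condition (U) on the boundary: `u` is on `T₁` the limit of a nondecreasing sequence of
continuous functions `u_n` on `T` with `P(∀ t, u_n(t) ≤ X_t ≤ u(t)) > 0`. -/
def CondU [TopologicalSpace T] (X : T → Ω → ℝ) (P : Measure Ω) (u : T → ℝ) : Prop :=
  ∃ un : ℕ → T → ℝ, (∀ n, Continuous (un n)) ∧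
    (∀ t ∉ zeroSet X P, Monotone (fun n => un n t) ∧
      Tendsto (fun n => un n t) atTop (𝓝 (u t))) ∧
    ∀ n, 0 < P {ω | ∀ t, un n t ≤ X t ω ∧ X t ω ≤ u t}

end

end NonCrossing

/-!
Let `ν` be the image on `T` of the finite measure `γ` on `T₁`, let `Y = ∫ X_t ν(dt)`, and let
`V = ∫∫ R dν dν = ‖γ‖²`. The variable `Y` is centered Gaussian with variance `V`, jointly Gaussian
with the process, and `E[X_t Y] = ∫ R(t, s) ν(ds) = f̃(t)`.

Upper bound. On the event `X + c f ≤ u`, integration against `ν` gives `Y ≤ ∫ u dν - c ∫ f dν`, and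
`∫ f dν ≥ ∫ f̃ dν = V` by `hG2`. Chernoff's inequality with parameter `-c` bounds the probability by
`exp (-c² V / 2 + c ∫ u dν)` (`measureReal_add_le_le_exp`).

Lower bound. By `hG3` the probability only decreases when `f` is replaced by `f̃ = ℛ γ`. The
Cameron--Martin formula (`map_tilted_eq_map_add`) writes the probability of `X + c f̃ ≤ u` as the
expectation of `exp (c Y - c² V / 2)` over the event `X ≤ u`. On the smaller event `u_n ≤ X ≤ u`,
whose probability `p_n` is positive, `Y ≥ ∫ u_n dν`, so the logarithm is at least
`-c² V / 2 + c ∫ u_n dν + log p_n` (`exp_mul_measure_le_measure_add_le`), and `∫ u_n dν → ∫ u dν` by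
monotone convergence.

The Cameron--Martin formula is proved by comparing the moment generating functions of finite linear
combinations of coordinates (`map_eq_map_of_mgf_eq`). They are explicit since a linear combination
of coordinates and of `Y` is a limit of Gaussian Riemann sums, hence Gaussian
(`map_add_pathIntegral_eq_gaussianReal`). The event `X ≤ u` involves uncountably many coordinates;
it is measurable because it corresponds to a closed set of continuous functions
(`exists_measurableSet_eq_preimage_of_isClosed`).
-/

namespace NonCrossing

/-! ### Path spaces and laws of processes -/

section Paths

variable {T Ω : Type*} [MeasurableSpace Ω] {P : Measure Ω}

/-- A process with almost surely continuous paths coincides, off one null set, with a process all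
of whose coordinates are measurable and all of whose paths are continuous. -/
theorem exists_continuous_modification [PseudoMetricSpace T]
    [TopologicalSpace.SeparableSpace T]
    {X : T → Ω → ℝ} (hX : ∀ t, AEMeasurable (X t) P)
    (hXc : ∀ᵐ ω ∂P, Continuous fun t => X t ω) :
    ∃ W : T → Ω → ℝ, (∀ t, Measurable (W t)) ∧ (∀ ω, Continuous fun t => W t ω) ∧
      ∀ᵐ ω ∂P, ∀ t, W t ω = X t ω := by
  classical
  obtain ⟨D, hDc, hD⟩ := TopologicalSpace.exists_countable_dense T
  have hgood : ∀ᵐ ω ∂P, (Continuous fun t => X t ω) ∧ ∀ d ∈ D, X d ω = (hX d).mk (X d) ω :=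
    hXc.and ((ae_ball_iff hDc).2 fun d _ => (hX d).ae_eq_mk)
  set N := toMeasurable P {ω | ¬((Continuous fun t => X t ω) ∧
    ∀ d ∈ D, X d ω = (hX d).mk (X d) ω)} with hN
  have hNm : MeasurableSet N := measurableSet_toMeasurable _ _
  have hN0 : P N = 0 := by rw [hN, measure_toMeasurable]; exact ae_iff.1 hgood
  have hNgood : ∀ ω ∉ N, (Continuous fun t => X t ω) ∧ ∀ d ∈ D, X d ω = (hX d).mk (X d) ω := by
    intro ω hω
    by_contra h
    exact hω (subset_toMeasurable _ _ h)
  have hcont : ∀ ω, Continuous fun t => if ω ∈ N then 0 else X t ω := by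
    intro ω
    by_cases hω : ω ∈ N
    · simpa [hω] using continuous_const
    · simpa [hω] using (hNgood ω hω).1
  have hmeasD : ∀ d ∈ D, Measurable fun ω => if ω ∈ N then 0 else X d ω := by
    intro d hd
    have : (fun ω => if ω ∈ N then 0 else X d ω) =
        fun ω => if ω ∈ N then 0 else (hX d).mk (X d) ω := by
      funext ω
      by_cases hω : ω ∈ N
      · simp [hω]
      · simp [hω, (hNgood ω hω).2 d hd]
    rw [this]
    exact Measurable.ite hNm measurable_const (hX d).measurable_mk
  refine ⟨fun t ω => if ω ∈ N then 0 else X t ω, fun t => ?_, hcont, ?_⟩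
  · obtain ⟨d, hdD, hdt⟩ := mem_closure_iff_seq_limit.1 (hD t)
    refine measurable_of_tendsto_metrizable (fun n => hmeasD (d n) (hdD n)) ?_
    rw [tendsto_pi_nhds]
    exact fun ω => ((hcont ω).tendsto t).comp hdt
  · have : ∀ᵐ ω ∂P, ω ∉ N := measure_eq_zero_iff_ae_notMem.1 hN0
    filter_upwards [this] with ω hω t
    simp [hω]

/-- Closed sets of continuous functions for the topology of uniform convergence are measurable for
the `σ`-algebra generated by the evaluations: they are traces of measurable sets of `T → ℝ`. This
is what makes non-crossing events measurable for boundaries without any regularity. -/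
theorem exists_measurableSet_eq_preimage_of_isClosed [PseudoMetricSpace T] [CompactSpace T]
    {A : Set C(T, ℝ)} (hA : IsClosed A) :
    ∃ B : Set (T → ℝ), MeasurableSet B ∧ (fun x : C(T, ℝ) => (x : T → ℝ)) ⁻¹' B = A := by
  let m : MeasurableSpace C(T, ℝ) :=
    MeasurableSpace.comap (fun x : C(T, ℝ) => (x : T → ℝ)) MeasurableSpace.pi
  suffices h : MeasurableSet[m] Aᶜ from h.of_compl
  obtain ⟨D, hDc, hD⟩ := TopologicalSpace.exists_countable_dense T
  obtain ⟨Q, hQc, hQ⟩ := TopologicalSpace.exists_countable_dense C(T, ℝ)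
  have heval : ∀ t, Measurable[m] fun x : C(T, ℝ) => x t := fun t =>
    (measurable_pi_apply t).comp (comap_measurable _)
  have hball : ∀ (q : C(T, ℝ)) (r : ℝ), 0 ≤ r → MeasurableSet[m] (Metric.closedBall q r) := by
    intro q r hr
    have : Metric.closedBall q r = ⋂ d ∈ D, {x : C(T, ℝ) | |x d - q d| ≤ r} := by
      ext x
      simp only [Metric.mem_closedBall, ContinuousMap.dist_le hr, Set.mem_iInter,
        Set.mem_ofPred_eq, ← Real.dist_eq]
      refine ⟨fun h d _ => h d, fun h t => ?_⟩
      have hcl : IsClosed {t | dist (x t) (q t) ≤ r} :=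
        isClosed_le (by fun_prop) continuous_const
      exact (hcl.closure_subset_iff.2 h) (hD t)
    rw [this]
    refine MeasurableSet.biInter hDc fun d _ => ?_
    exact ((heval d).sub_const (q d)) (isClosed_le continuous_abs continuous_const).measurableSet
  have hU : Aᶜ = ⋃ q ∈ Q, ⋃ r ∈ {r : ℚ | 0 ≤ (r : ℝ) ∧ Metric.closedBall q (r : ℝ) ⊆ Aᶜ},
      Metric.closedBall q (r : ℝ) := by
    refine Set.Subset.antisymm (fun x hx => ?_) ?_
    · obtain ⟨ε, hε, hεA⟩ := Metric.isOpen_iff.1 hA.isOpen_compl x hx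
      obtain ⟨r, hr0, hr⟩ := exists_rat_btwn (half_pos hε)
      obtain ⟨q, hq, hqQ⟩ := hQ.exists_dist_lt x hr0
      simp only [Set.mem_iUnion]
      refine ⟨q, hq, r, ⟨hr0.le, fun y hy => hεA ?_⟩, hqQ.le⟩
      rw [Metric.mem_closedBall] at hy
      rw [Metric.mem_ball]
      linarith [dist_triangle y q x, dist_comm x q]
    · simp only [Set.iUnion_subset_iff]
      exact fun q _ r hr => hr.2
  rw [hU]
  exact MeasurableSet.biUnion hQc fun q _ =>
    MeasurableSet.biUnion (Set.to_countable _) fun r hr => hball q r hr.1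

/-- Two measures on the space of all functions agree if all finite linear combinations of
coordinates have the same, everywhere finite, moment generating functions. -/
theorem map_eq_map_of_mgf_eq {X X' : T → Ω → ℝ} {μ μ' : Measure Ω} [IsProbabilityMeasure μ]
    [IsProbabilityMeasure μ'] (hX : ∀ t, Measurable (X t)) (hX' : ∀ t, Measurable (X' t))
    (hint : ∀ (I : Finset T) (a : I → ℝ) (s : ℝ),
      Integrable (fun ω => Real.exp (s * ∑ i, a i * X i ω)) μ)
    (h : ∀ (I : Finset T) (a : I → ℝ),
      mgf (fun ω => ∑ i, a i * X i ω) μ = mgf (fun ω => ∑ i, a i * X' i ω) μ') :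
    μ.map (fun ω t => X t ω) = μ'.map (fun ω t => X' t ω) := by
  classical
  have hmX : Measurable fun ω t => X t ω := measurable_pi_lambda _ hX
  have hmX' : Measurable fun ω t => X' t ω := measurable_pi_lambda _ hX'
  have hp : IsProbabilityMeasure (μ'.map fun ω t => X' t ω) :=
    Measure.isProbabilityMeasure_map hmX'.aemeasurable
  refine IsProjectiveLimit.unique
    (P := fun I : Finset T => (μ'.map fun ω t => X' t ω).map I.restrict)
    (fun I => ?_) (fun I => rfl)
  have hr : Measurable (I.restrict : (T → ℝ) → (I → ℝ)) := Finset.measurable_restrict I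
  beta_reduce
  rw [Measure.map_map hr hmX, Measure.map_map hr hmX']
  have := Measure.isProbabilityMeasure_map (μ := μ) (hr.comp hmX).aemeasurable
  have := Measure.isProbabilityMeasure_map (μ := μ') (hr.comp hmX').aemeasurable
  refine Measure.ext_of_charFunDual (funext fun L => ?_)
  have hL : ∀ x : I → ℝ, L x = ∑ i, L (Pi.single i 1) * x i := by
    intro x
    conv_lhs => rw [pi_eq_sum_univ' x]
    rw [map_sum]
    refine Finset.sum_congr rfl fun i _ => ?_
    rw [map_smul, smul_eq_mul, mul_comm]
  rw [charFunDual_eq_charFun_map_one, charFunDual_eq_charFun_map_one,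
    Measure.map_map (by fun_prop) (hr.comp hmX), Measure.map_map (by fun_prop) (hr.comp hmX')]
  have e1 : (L ∘ I.restrict ∘ fun ω t => X t ω) =
      fun ω => ∑ i, L (Pi.single i 1) * X i ω := by
    funext ω; exact hL _
  have e2 : (L ∘ I.restrict ∘ fun ω t => X' t ω) =
      fun ω => ∑ i, L (Pi.single i 1) * X' i ω := by
    funext ω; exact hL _
  rw [e1, e2]
  congr 1
  have hset : integrableExpSet (fun ω => ∑ i, L (Pi.single i 1) * X i ω) μ = Set.univ :=
    Set.eq_univ_of_forall fun s => hint I _ s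
  refine Measure.ext_of_complexMGF_eq
    (Finset.measurable_fun_sum _ fun i _ => (hX i.1).const_mul _).aemeasurable
    (Finset.measurable_fun_sum _ fun i _ => (hX' i.1).const_mul _).aemeasurable (funext fun z => ?_)
  exact eqOn_complexMGF_of_mgf (h I fun i => L (Pi.single i 1)) (by
    rw [Set.mem_ofPred_eq, hset, interior_univ]; trivial)

end Paths

/-! ### Gaussian processes and their covariance -/

section Gaussian

variable {T Ω : Type*} [MeasurableSpace Ω] {P : Measure Ω} {X : T → Ω → ℝ}

/-- Every element of the linear span of a Gaussian process is Gaussian. -/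
theorem hasGaussianLaw_of_mem_span (hX : IsGaussianProcess X P) {Z : Ω → ℝ}
    (hZ : Z ∈ Submodule.span ℝ (Set.range X)) : HasGaussianLaw Z P := by
  obtain ⟨a, rfl⟩ := Finsupp.mem_span_range_iff_exists_finsupp.1 hZ
  exact (hX.smul fun t => a t).hasGaussianLaw_sum (I := a.support)

theorem integral_eq_zero_of_mem_span (hX : IsGaussianProcess X P)
    (hX0 : ∀ t, ∫ ω, X t ω ∂P = 0) {Z : Ω → ℝ}
    (hZ : Z ∈ Submodule.span ℝ (Set.range X)) : ∫ ω, Z ω ∂P = 0 := by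
  induction hZ using Submodule.span_induction with
  | mem Z h => obtain ⟨t, rfl⟩ := h; exact hX0 t
  | zero => simp
  | add Z Z' hZ hZ' h h' =>
    have := integral_add (hasGaussianLaw_of_mem_span hX hZ).integrable
      (hasGaussianLaw_of_mem_span hX hZ').integrable
    simpa [h, h'] using this
  | smul a Z hZ h => simp [integral_const_mul, h]

theorem map_eq_gaussianReal_of_mem_span (hX : IsGaussianProcess X P)
    (hX0 : ∀ t, ∫ ω, X t ω ∂P = 0) {Z : Ω → ℝ}
    (hZ : Z ∈ Submodule.span ℝ (Set.range X)) :
    P.map Z = gaussianReal 0 (∫ ω, Z ω ^ 2 ∂P).toNNReal := by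
  have h := hasGaussianLaw_of_mem_span hX hZ
  rw [h.map_eq_gaussianReal, variance_eq_integral h.aemeasurable,
    integral_eq_zero_of_mem_span hX hX0 hZ]
  simp

/-- The characteristic function of a centered Gaussian variable. -/
theorem integral_cexp_of_map_eq_gaussianReal {Z : Ω → ℝ} (hZm : AEMeasurable Z P) {v : ℝ}
    (hv : 0 ≤ v) (hZ : P.map Z = gaussianReal 0 v.toNNReal) (s : ℝ) :
    ∫ ω, Complex.exp (s * Z ω * Complex.I) ∂P = Complex.exp (-(v * s ^ 2 / 2)) := by
  have h := charFun_gaussianReal (μ := 0) (v := v.toNNReal) s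
  rw [← hZ, charFun_apply_real, integral_map hZm (by fun_prop)] at h
  rw [h]
  congr 1
  simp [hv]

/-- An almost sure limit of centered Gaussian variables whose variances converge is Gaussian. -/
theorem map_eq_gaussianReal_of_tendsto [IsProbabilityMeasure P] {Zn : ℕ → Ω → ℝ} {Z : Ω → ℝ}
    {vn : ℕ → ℝ} {v : ℝ} (hZn : ∀ n, AEMeasurable (Zn n) P) (hvn : ∀ n, 0 ≤ vn n)
    (hlaw : ∀ n, P.map (Zn n) = gaussianReal 0 (vn n).toNNReal)
    (hlim : ∀ᵐ ω ∂P, Tendsto (fun n => Zn n ω) atTop (𝓝 (Z ω)))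
    (hv : Tendsto vn atTop (𝓝 v)) :
    P.map Z = gaussianReal 0 v.toNNReal := by
  have hZ : AEMeasurable Z P := aemeasurable_of_tendsto_metrizable_ae' hZn hlim
  have hv0 : 0 ≤ v := ge_of_tendsto' hv hvn
  have := Measure.isProbabilityMeasure_map (μ := P) hZ
  refine Measure.ext_of_charFun (funext fun s => ?_)
  rw [charFun_apply_real, integral_map hZ (by fun_prop), charFun_gaussianReal]
  have h1 : Tendsto (fun n => ∫ ω, Complex.exp (s * Zn n ω * Complex.I) ∂P) atTop
      (𝓝 (∫ ω, Complex.exp (s * Z ω * Complex.I) ∂P)) := by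
    refine tendsto_integral_of_dominated_convergence (fun _ => 1) (fun n => ?_)
      (integrable_const _) (fun n => ?_) ?_
    · have := hZn n
      exact AEMeasurable.aestronglyMeasurable (by fun_prop)
    · refine ae_of_all _ fun ω => ?_
      rw [← Complex.ofReal_mul, Complex.norm_exp_ofReal_mul_I]
    · filter_upwards [hlim] with ω hω
      have hc : Continuous fun x : ℝ => Complex.exp (s * x * Complex.I) := by fun_prop
      exact (hc.tendsto _).comp hω
  have h2 : Tendsto (fun n => ∫ ω, Complex.exp (s * Zn n ω * Complex.I) ∂P) atTop
      (𝓝 (Complex.exp (-(v * s ^ 2 / 2)))) := by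
    simp_rw [fun n => integral_cexp_of_map_eq_gaussianReal (hZn n) (hvn n) (hlaw n) s]
    have hc : Continuous fun x : ℝ => Complex.exp (-(x * s ^ 2 / 2)) := by fun_prop
    exact (hc.tendsto _).comp hv
  rw [tendsto_nhds_unique h1 h2]
  congr 1
  simp [hv0]

/-- The moment generating function of a centered Gaussian variable at `1`. -/
theorem integral_exp_of_map_eq_gaussianReal {Z : Ω → ℝ} {v : ℝ} (hv : 0 ≤ v)
    (hZ : P.map Z = gaussianReal 0 v.toNNReal) :
    ∫ ω, Real.exp (Z ω) ∂P = Real.exp (v / 2) := by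
  have h := mgf_gaussianReal hZ 1
  simpa [mgf, hv] using h

theorem integrable_exp_of_map_eq_gaussianReal {Z : Ω → ℝ} {v : ℝ} (hv : 0 ≤ v)
    (hZ : P.map Z = gaussianReal 0 v.toNNReal) :
    Integrable (fun ω => Real.exp (Z ω)) P := by
  by_contra h
  have h1 := integral_exp_of_map_eq_gaussianReal hv hZ
  rw [integral_undef h] at h1
  exact (Real.exp_pos _).ne h1

theorem integrable_mul_process (hX : IsGaussianProcess X P) (t s : T) :
    Integrable (fun ω => X t ω * X s ω) P :=
  (hX.hasGaussianLaw_eval t).memLp_two.integrable_mul (hX.hasGaussianLaw_eval s).memLp_two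

/-- The covariance function of a Gaussian process with continuous paths is continuous: the
characteristic functions of `X t + X s` and `X t - X s` are continuous in `(t, s)` by dominated
convergence, and they determine the variances, hence by polarization the covariance. -/
theorem continuous_covFun [TopologicalSpace T] [FirstCountableTopology T]
    (hX : IsGaussianProcess X P) (hX0 : ∀ t, ∫ ω, X t ω ∂P = 0)
    (hXc : ∀ ω, Continuous fun t => X t ω) :
    Continuous fun p : T × T => covFun X P p.1 p.2 := by
  have := hX.isProbabilityMeasure
  have key : ∀ e : ℝ, Continuous fun p : T × T => ∫ ω, (X p.1 ω + e * X p.2 ω) ^ 2 ∂P := by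
    intro e
    have hmem : ∀ p : T × T, X p.1 + e • X p.2 ∈ Submodule.span ℝ (Set.range X) := fun p =>
      add_mem (Submodule.subset_span ⟨_, rfl⟩)
        (Submodule.smul_mem _ _ (Submodule.subset_span ⟨_, rfl⟩))
    have hchar : ∀ p : T × T, ∫ ω, (X p.1 ω + e * X p.2 ω) ^ 2 ∂P =
        -2 * Real.log
          ‖∫ ω, Complex.exp ((1 : ℝ) * ((X p.1 + e • X p.2) ω : ℝ) * Complex.I) ∂P‖ := by
      intro p
      rw [integral_cexp_of_map_eq_gaussianReal (hasGaussianLaw_of_mem_span hX (hmem p)).aemeasurable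
        (integral_nonneg fun ω => sq_nonneg _) (map_eq_gaussianReal_of_mem_span hX hX0 (hmem p)) 1,
        Complex.norm_exp, Real.log_exp]
      have : (-(((∫ ω, (X p.1 + e • X p.2) ω ^ 2 ∂P : ℝ) : ℂ) * ((1 : ℝ) : ℂ) ^ 2 / 2)).re =
          -((∫ ω, (X p.1 + e • X p.2) ω ^ 2 ∂P) / 2) := by
        rw [show (-(((∫ ω, (X p.1 + e • X p.2) ω ^ 2 ∂P : ℝ) : ℂ) * ((1 : ℝ) : ℂ) ^ 2 / 2)) =
          ((-((∫ ω, (X p.1 + e • X p.2) ω ^ 2 ∂P) / 2) : ℝ) : ℂ) by push_cast; ring]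
        exact Complex.ofReal_re _
      rw [this]
      simp only [Pi.add_apply, Pi.smul_apply, smul_eq_mul]
      ring
    simp_rw [hchar]
    refine continuous_const.mul (Continuous.log (Continuous.norm ?_) fun p => ?_)
    · refine continuous_of_dominated (bound := fun _ => 1) (fun p => ?_) (fun p => ?_)
        (integrable_const _) (ae_of_all _ fun ω => ?_)
      · have := (hasGaussianLaw_of_mem_span hX (hmem p)).aemeasurable
        exact AEMeasurable.aestronglyMeasurable (by fun_prop)
      · refine ae_of_all _ fun ω => ?_
        rw [← Complex.ofReal_mul, Complex.norm_exp_ofReal_mul_I]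
      · have h1 : Continuous fun p : T × T => X p.1 ω := (hXc ω).comp continuous_fst
        have h2 : Continuous fun p : T × T => X p.2 ω := (hXc ω).comp continuous_snd
        simp only [Pi.add_apply, Pi.smul_apply, smul_eq_mul]
        fun_prop
    · rw [integral_cexp_of_map_eq_gaussianReal (hasGaussianLaw_of_mem_span hX (hmem p)).aemeasurable
        (integral_nonneg fun ω => sq_nonneg _) (map_eq_gaussianReal_of_mem_span hX hX0 (hmem p)) 1]
      exact norm_ne_zero_iff.2 (Complex.exp_ne_zero _)
  have hpol : ∀ p : T × T, covFun X P p.1 p.2 = ((∫ ω, (X p.1 ω + 1 * X p.2 ω) ^ 2 ∂P) -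
      ∫ ω, (X p.1 ω + (-1) * X p.2 ω) ^ 2 ∂P) / 4 := by
    intro p
    have hi : ∀ e : ℝ, Integrable (fun ω => (X p.1 ω + e * X p.2 ω) ^ 2) P := fun e =>
      ((hX.hasGaussianLaw_eval p.1).memLp_two.add
        ((hX.hasGaussianLaw_eval p.2).memLp_two.const_mul e)).integrable_sq
    rw [← integral_sub (hi _) (hi _), ← integral_div]
    refine integral_congr_ae (ae_of_all _ fun ω => ?_)
    ring
  simp_rw [hpol]
  exact ((key 1).sub (key (-1))).div_const 4

end Gaussian

/-! ### Path integrals and the Cameron--Martin formula -/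

section PathIntegral

variable {T Ω : Type*} [MeasurableSpace Ω] {P : Measure Ω} {X : T → Ω → ℝ}

theorem integral_comp_simpleFunc {S : Type*} [MeasurableSpace S] (ν : Measure S)
    [IsFiniteMeasure ν] (π : SimpleFunc S T) (g : T → ℝ) :
    ∫ s, g (π s) ∂ν = ∑ x ∈ π.range, ν.real (π ⁻¹' {x}) * g x := by
  classical
  have h : ∀ s, g (π s) = ∑ x ∈ π.range, (π ⁻¹' {x}).indicator (fun _ => g x) s := by
    intro s
    rw [Finset.sum_eq_single (π s)]
    · simp
    · intro x _ hx
      exact Set.indicator_of_notMem (fun h => hx h.symm) _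
    · exact fun h => (h (π.mem_range_self s)).elim
  simp_rw [h]
  rw [integral_finsetSum]
  · refine Finset.sum_congr rfl fun x _ => ?_
    rw [integral_indicator_const _ (π.measurableSet_fiber x), smul_eq_mul]
  · exact fun x _ => (integrable_const _).indicator (π.measurableSet_fiber x)

variable [MetricSpace T] [CompactSpace T] [MeasurableSpace T] [BorelSpace T]

theorem integrable_of_continuous (ν : Measure T) [IsFiniteMeasure ν] {g : T → ℝ}
    (hg : Continuous g) : Integrable g ν :=
  hg.integrable_of_hasCompactSupport (HasCompactSupport.of_compactSpace g)

/-- Integrals of a continuous function over discretizations of the space converge. -/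
theorem tendsto_integral_comp_simpleFunc (ν : Measure T) [IsFiniteMeasure ν]
    {π : ℕ → SimpleFunc T T} (hπ : ∀ t, Tendsto (fun n => π n t) atTop (𝓝 t)) {g : T → ℝ}
    (hg : Continuous g) :
    Tendsto (fun n => ∫ s, g (π n s) ∂ν) atTop (𝓝 (∫ s, g s ∂ν)) := by
  obtain ⟨C, hC⟩ := isCompact_univ.exists_bound_of_continuousOn hg.continuousOn
  refine tendsto_integral_of_dominated_convergence (fun _ => C) (fun n => ?_)
    (integrable_const _) (fun n => ae_of_all _ fun s => hC _ trivial)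
    (ae_of_all _ fun s => (hg.tendsto _).comp (hπ s))
  exact (hg.measurable.comp (π n).measurable).aestronglyMeasurable

theorem continuous_integral_right (ν : Measure T) [IsFiniteMeasure ν] {R : T → T → ℝ}
    (hR : Continuous fun p : T × T => R p.1 p.2) : Continuous fun t => ∫ s, R t s ∂ν := by
  obtain ⟨C, hC⟩ := isCompact_univ.exists_bound_of_continuousOn hR.continuousOn
  refine continuous_of_dominated (bound := fun _ => C) (fun t => ?_)
    (fun t => ae_of_all _ fun s => hC (t, s) trivial) (integrable_const _)
    (ae_of_all _ fun s => hR.comp (by fun_prop : Continuous fun t => (t, s)))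
  have : Continuous fun s => R t s := hR.comp (by fun_prop : Continuous fun s => (t, s))
  exact this.aestronglyMeasurable

theorem tendsto_integral_integral_comp_simpleFunc (ν : Measure T) [IsFiniteMeasure ν]
    {π : ℕ → SimpleFunc T T} (hπ : ∀ t, Tendsto (fun n => π n t) atTop (𝓝 t)) {R : T → T → ℝ}
    (hR : Continuous fun p : T × T => R p.1 p.2) :
    Tendsto (fun n => ∫ t, ∫ s, R (π n t) (π n s) ∂ν ∂ν) atTop (𝓝 (∫ t, ∫ s, R t s ∂ν ∂ν)) := by
  obtain ⟨C, hC⟩ := isCompact_univ.exists_bound_of_continuousOn hR.continuousOn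
  have hm : ∀ n t, AEStronglyMeasurable (fun s => R t (π n s)) ν := by
    intro n t
    have : Continuous fun s => R t s := hR.comp (by fun_prop : Continuous fun s => (t, s))
    exact (this.measurable.comp (π n).measurable).aestronglyMeasurable
  refine tendsto_integral_of_dominated_convergence (fun _ => C * ν.real Set.univ) (fun n => ?_)
    (integrable_const _) (fun n => ae_of_all _ fun t => ?_) (ae_of_all _ fun t => ?_)
  · -- the inner integral is a function of the simple function `π n`
    exact ((π n).map fun t => ∫ s, R t (π n s) ∂ν).aestronglyMeasurable
  · exact norm_integral_le_of_norm_le_const (ae_of_all _ fun s => hC (π n t, π n s) trivial)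
  · refine tendsto_integral_of_dominated_convergence (fun _ => C) (fun n => hm n _)
      (integrable_const _) (fun n => ae_of_all _ fun s => hC (π n t, π n s) trivial)
      (ae_of_all _ fun s => ?_)
    exact (hR.tendsto (t, s)).comp ((hπ t).prodMk_nhds (hπ s))

/-- A linear combination of coordinates and of the path integral `∫ X_t ν(dt)` is a centered
Gaussian variable, with the variance given by the covariance function. The path integral is the
limit of its Riemann sums, along discretizations of the identity by simple functions. -/
theorem map_add_pathIntegral_eq_gaussianReal (hX : IsGaussianProcess X P)
    (hX0 : ∀ t, ∫ ω, X t ω ∂P = 0) (hXc : ∀ ω, Continuous fun t => X t ω)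
    (ν : Measure T) [IsFiniteMeasure ν] {S : Ω → ℝ}
    (hS : S ∈ Submodule.span ℝ (Set.range X))
    (hScov : Continuous fun t => ∫ ω, S ω * X t ω ∂P) (c : ℝ) :
    0 ≤ (∫ ω, S ω ^ 2 ∂P) + 2 * c * (∫ t, ∫ ω, S ω * X t ω ∂P ∂ν) +
        c ^ 2 * ∫ t, ∫ s, covFun X P t s ∂ν ∂ν ∧
    P.map (fun ω => S ω + c * ∫ t, X t ω ∂ν) =
      gaussianReal 0 ((∫ ω, S ω ^ 2 ∂P) + 2 * c * (∫ t, ∫ ω, S ω * X t ω ∂P ∂ν) +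
        c ^ 2 * ∫ t, ∫ s, covFun X P t s ∂ν ∂ν).toNNReal := by
  have := hX.isProbabilityMeasure
  have hR := continuous_covFun hX hX0 hXc
  have hid : StronglyMeasurable (id : T → T) := stronglyMeasurable_id
  set π := hid.approx
  have hπ : ∀ t, Tendsto (fun n => π n t) atTop (𝓝 t) := hid.tendsto_approx
  let w : ℕ → T → ℝ := fun n x => ν.real (π n ⁻¹' {x})
  let Yn : ℕ → Ω → ℝ := fun n => ∑ x ∈ (π n).range, w n x • X x
  have hYn : ∀ n ω, Yn n ω = ∫ s, X (π n s) ω ∂ν := by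
    intro n ω
    rw [integral_comp_simpleFunc ν (π n) fun t => X t ω]
    simp [Yn, w]
  have hYmem : ∀ n, Yn n ∈ Submodule.span ℝ (Set.range X) := fun n =>
    Submodule.sum_mem _ fun x _ => Submodule.smul_mem _ _ (Submodule.subset_span ⟨x, rfl⟩)
  have hZmem : ∀ n, S + c • Yn n ∈ Submodule.span ℝ (Set.range X) := fun n =>
    add_mem hS (Submodule.smul_mem _ _ (hYmem n))
  have hmul : ∀ {Z : Ω → ℝ}, Z ∈ Submodule.span ℝ (Set.range X) → ∀ n,
      ∫ ω, Z ω * Yn n ω ∂P = ∫ s, ∫ ω, Z ω * X (π n s) ω ∂P ∂ν := by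
    intro Z hZ n
    rw [integral_comp_simpleFunc ν (π n) fun t => ∫ ω, Z ω * X t ω ∂P]
    have : (fun ω => Z ω * Yn n ω) =
        fun ω => ∑ x ∈ (π n).range, w n x * (Z ω * X x ω) := by
      funext ω
      simp only [Yn, Finset.sum_apply, Pi.smul_apply, smul_eq_mul, Finset.mul_sum]
      exact Finset.sum_congr rfl fun x _ => by ring
    rw [this, integral_finsetSum]
    · exact Finset.sum_congr rfl fun x _ => integral_const_mul _ _
    · exact fun x _ => ((hasGaussianLaw_of_mem_span hX hZ).memLp_two.integrable_mul
        (hX.hasGaussianLaw_eval x).memLp_two).const_mul _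
  have hvar : ∀ n, ∫ ω, (S + c • Yn n) ω ^ 2 ∂P =
      (∫ ω, S ω ^ 2 ∂P) + 2 * c * (∫ s, ∫ ω, S ω * X (π n s) ω ∂P ∂ν) +
        c ^ 2 * ∫ t, ∫ s, covFun X P (π n t) (π n s) ∂ν ∂ν := by
    intro n
    have hYY : ∫ ω, Yn n ω * Yn n ω ∂P =
        ∫ t, ∫ s, covFun X P (π n t) (π n s) ∂ν ∂ν := by
      rw [hmul (hYmem n) n]
      refine integral_congr_ae (ae_of_all _ fun t => ?_)
      have := hmul (Submodule.subset_span ⟨π n t, rfl⟩) n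
      simp only [covFun]
      rw [← this]
      exact integral_congr_ae (ae_of_all _ fun ω => mul_comm _ _)
    have hLS := (hasGaussianLaw_of_mem_span hX hS).memLp_two
    have hLY := (hasGaussianLaw_of_mem_span hX (hYmem n)).memLp_two
    have hi1 : Integrable (fun ω => S ω ^ 2) P := hLS.integrable_sq
    have hi2 : Integrable (fun ω => 2 * c * (S ω * Yn n ω)) P :=
      (hLS.integrable_mul hLY).const_mul _
    have hi3 : Integrable (fun ω => c ^ 2 * (Yn n ω * Yn n ω)) P :=
      (hLY.integrable_mul hLY).const_mul _
    have hi12 : Integrable (fun ω => S ω ^ 2 + 2 * c * (S ω * Yn n ω)) P := hi1.add hi2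
    rw [← hYY, ← hmul hS n, ← integral_const_mul, ← integral_const_mul,
      ← integral_add hi1 hi2, ← integral_add hi12 hi3]
    refine integral_congr_ae (ae_of_all _ fun ω => ?_)
    simp only [Pi.add_apply, Pi.smul_apply, smul_eq_mul]
    ring
  have hv : Tendsto (fun n => ∫ ω, (S + c • Yn n) ω ^ 2 ∂P) atTop
      (𝓝 ((∫ ω, S ω ^ 2 ∂P) + 2 * c * (∫ t, ∫ ω, S ω * X t ω ∂P ∂ν) +
        c ^ 2 * ∫ t, ∫ s, covFun X P t s ∂ν ∂ν)) := by
    simp_rw [hvar]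
    exact (tendsto_const_nhds.add
      ((tendsto_integral_comp_simpleFunc ν hπ hScov).const_mul _)).add
      ((tendsto_integral_integral_comp_simpleFunc ν hπ hR).const_mul _)
  refine ⟨ge_of_tendsto' hv fun n => integral_nonneg fun ω => sq_nonneg _,
    map_eq_gaussianReal_of_tendsto
      (fun n => (hasGaussianLaw_of_mem_span hX (hZmem n)).aemeasurable)
      (fun n => integral_nonneg fun ω => sq_nonneg _)
      (fun n => map_eq_gaussianReal_of_mem_span hX hX0 (hZmem n)) (ae_of_all _ fun ω => ?_) hv⟩
  simp only [Pi.add_apply, Pi.smul_apply, smul_eq_mul, hYn]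
  exact tendsto_const_nhds.add ((tendsto_integral_comp_simpleFunc ν hπ (hXc ω)).const_mul c)

theorem pathIntegral_variance_nonneg (hX : IsGaussianProcess X P)
    (hX0 : ∀ t, ∫ ω, X t ω ∂P = 0) (hXc : ∀ ω, Continuous fun t => X t ω)
    (ν : Measure T) [IsFiniteMeasure ν] : 0 ≤ ∫ t, ∫ s, covFun X P t s ∂ν ∂ν := by
  simpa using (map_add_pathIntegral_eq_gaussianReal hX hX0 hXc ν (Submodule.zero_mem _)
    (by simpa using continuous_const) 1).1

theorem map_pathIntegral_eq_gaussianReal (hX : IsGaussianProcess X P)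
    (hX0 : ∀ t, ∫ ω, X t ω ∂P = 0) (hXc : ∀ ω, Continuous fun t => X t ω)
    (ν : Measure T) [IsFiniteMeasure ν] :
    P.map (fun ω => ∫ t, X t ω ∂ν) =
      gaussianReal 0 (∫ t, ∫ s, covFun X P t s ∂ν ∂ν).toNNReal := by
  simpa using (map_add_pathIntegral_eq_gaussianReal hX hX0 hXc ν (Submodule.zero_mem _)
    (by simpa using continuous_const) 1).2

theorem mgf_pathIntegral (hX : IsGaussianProcess X P)
    (hX0 : ∀ t, ∫ ω, X t ω ∂P = 0) (hXc : ∀ ω, Continuous fun t => X t ω)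
    (ν : Measure T) [IsFiniteMeasure ν] (c : ℝ) :
    ∫ ω, Real.exp (c * ∫ t, X t ω ∂ν) ∂P =
      Real.exp (c ^ 2 / 2 * ∫ t, ∫ s, covFun X P t s ∂ν ∂ν) := by
  have h := mgf_gaussianReal (map_pathIntegral_eq_gaussianReal hX hX0 hXc ν) c
  rw [mgf] at h
  rw [h, Real.coe_toNNReal _ (pathIntegral_variance_nonneg hX hX0 hXc ν)]
  ring_nf

theorem integrable_exp_pathIntegral (hX : IsGaussianProcess X P)
    (hX0 : ∀ t, ∫ ω, X t ω ∂P = 0) (hXc : ∀ ω, Continuous fun t => X t ω)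
    (ν : Measure T) [IsFiniteMeasure ν] (c : ℝ) :
    Integrable (fun ω => Real.exp (c * ∫ t, X t ω ∂ν)) P := by
  by_contra h
  have h1 := mgf_pathIntegral hX hX0 hXc ν c
  rw [integral_undef h] at h1
  exact (Real.exp_pos _).ne h1

/-- The Cameron--Martin formula for a shift in the range of the covariance operator: under the
measure with density proportional to `exp (c ∫ X_t ν(dt))` the process has the law of
`X + c ∫ R(·, s) ν(ds)`. -/
theorem map_tilted_eq_map_add (hX : IsGaussianProcess X P)
    (hX0 : ∀ t, ∫ ω, X t ω ∂P = 0) (hXm : ∀ t, Measurable (X t))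
    (hXc : ∀ ω, Continuous fun t => X t ω) (ν : Measure T) [IsFiniteMeasure ν] (c : ℝ) :
    P.map (fun ω t => X t ω + c * ∫ s, covFun X P t s ∂ν) =
      (P.tilted fun ω => c * ∫ t, X t ω ∂ν).map (fun ω t => X t ω) := by
  have := hX.isProbabilityMeasure
  have hR := continuous_covFun hX hX0 hXc
  have hexp := integrable_exp_pathIntegral hX hX0 hXc ν c
  have := isProbabilityMeasure_tilted hexp
  have hcomb : ∀ (I : Finset T) (a : I → ℝ), ∑ i, a i • X i ∈ Submodule.span ℝ (Set.range X) :=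
    fun I a => Submodule.sum_mem _ fun i _ =>
      Submodule.smul_mem _ _ (Submodule.subset_span ⟨i, rfl⟩)
  have hcomb_mul : ∀ (I : Finset T) (a : I → ℝ) (t : T),
      ∫ ω, (∑ i, a i • X i) ω * X t ω ∂P = ∑ i, a i * covFun X P i t := by
    intro I a t
    have : (fun ω => (∑ i, a i • X i) ω * X t ω) =
        fun ω => ∑ i, a i * (X i ω * X t ω) := by
      funext ω
      simp only [Finset.sum_apply, Pi.smul_apply, smul_eq_mul, Finset.sum_mul]
      exact Finset.sum_congr rfl fun x _ => by ring
    rw [this, integral_finsetSum _ fun i _ => (integrable_mul_process hX i.1 t).const_mul _]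
    exact Finset.sum_congr rfl fun x _ => integral_const_mul _ _
  have hRc : ∀ t, Continuous fun s => covFun X P t s := fun t =>
    hR.comp (by fun_prop : Continuous fun s => (t, s))
  have hcov : ∀ (I : Finset T) (a : I → ℝ),
      Continuous fun t => ∫ ω, (∑ i, a i • X i) ω * X t ω ∂P := by
    intro I a
    simp_rw [hcomb_mul]
    exact continuous_finsetSum _ fun i _ => continuous_const.mul (hRc i.1)
  -- scaling is absorbed in the coefficients
  have hscale : ∀ (I : Finset T) (a : I → ℝ) (r : ℝ) (ω : Ω),
      r * ∑ i, a i * X i ω = (∑ i, (r * a i) • X i) ω := by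
    intro I a r ω
    simp [Finset.mul_sum, mul_assoc]
  have hshift : ∀ (I : Finset T) (a : I → ℝ) (r : ℝ) (ω : Ω),
      Real.exp (r * ∑ i, a i * (X i ω + c * ∫ s, covFun X P i s ∂ν)) =
        Real.exp ((∑ i, (r * a i) • X i) ω) *
          Real.exp (r * ∑ i, a i * (c * ∫ s, covFun X P i s ∂ν)) := by
    intro I a r ω
    rw [← Real.exp_add, ← hscale, ← mul_add, ← Finset.sum_add_distrib]
    simp_rw [mul_add]
  refine map_eq_map_of_mgf_eq (fun t => (hXm t).add_const _) hXm (fun I a r => ?_)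
    (fun I a => funext fun r => ?_)
  · simp_rw [hshift]
    exact (integrable_exp_of_map_eq_gaussianReal (integral_nonneg fun ω => sq_nonneg _)
      (map_eq_gaussianReal_of_mem_span hX hX0 (hcomb I _))).mul_const _
  · obtain ⟨hv, hlaw⟩ := map_add_pathIntegral_eq_gaussianReal hX hX0 hXc ν
      (hcomb I fun i => r * a i) (hcov I _) c
    simp only [mgf]
    simp_rw [hshift]
    rw [integral_mul_const, integral_exp_of_map_eq_gaussianReal
      (integral_nonneg fun ω => sq_nonneg _) (map_eq_gaussianReal_of_mem_span hX hX0 (hcomb I _)),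
      integral_exp_tilted, mgf_pathIntegral hX hX0 hXc ν c, ← Real.exp_add]
    have h2 : ∀ ω, Real.exp (((fun ω => c * ∫ t, X t ω ∂ν) +
        fun ω => r * ∑ i, a i * X i ω) ω) =
        Real.exp ((∑ i, (r * a i) • X i) ω + c * ∫ t, X t ω ∂ν) := by
      intro ω
      rw [Pi.add_apply, hscale, add_comm]
    simp_rw [h2]
    rw [integral_exp_of_map_eq_gaussianReal hv hlaw, ← Real.exp_sub]
    congr 1
    simp_rw [hcomb_mul]
    rw [integral_finsetSum _ fun i _ => (integrable_of_continuous ν (hRc i.1)).const_mul _]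
    simp_rw [integral_const_mul, Finset.mul_sum]
    have : ∑ i, r * (a i * (c * ∫ s, covFun X P i s ∂ν)) =
        c * ∑ i, r * a i * ∫ s, covFun X P i s ∂ν := by
      rw [Finset.mul_sum]
      exact Finset.sum_congr rfl fun i _ => by ring
    rw [this, ← Finset.mul_sum]
    ring

end PathIntegral

/-! ### Bounds for non-crossing probabilities -/

section Asymptotics

variable {T Ω : Type*} [MeasurableSpace Ω] {P : Measure Ω} {X : T → Ω → ℝ}
  [MetricSpace T] [CompactSpace T] [MeasurableSpace T] [BorelSpace T]

theorem continuous_covOp (hX : IsGaussianProcess X P)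
    (hX0 : ∀ t, ∫ ω, X t ω ∂P = 0) (hXc : ∀ ω, Continuous fun t => X t ω)
    (ν : Measure T) [IsFiniteMeasure ν] : Continuous fun t => ∫ s, covFun X P t s ∂ν :=
  continuous_integral_right ν (continuous_covFun hX hX0 hXc)

/-- The Cameron--Martin formula for non-crossing events. -/
theorem measure_add_le_eq_tilted (hX : IsGaussianProcess X P)
    (hX0 : ∀ t, ∫ ω, X t ω ∂P = 0) (hXm : ∀ t, Measurable (X t))
    (hXc : ∀ ω, Continuous fun t => X t ω) (ν : Measure T) [IsFiniteMeasure ν] (u : T → ℝ)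
    (c : ℝ) :
    P {ω | ∀ t, X t ω + c * ∫ s, covFun X P t s ∂ν ≤ u t} =
      (P.tilted fun ω => c * ∫ t, X t ω ∂ν) {ω | ∀ t, X t ω ≤ u t} := by
  have hcl : IsClosed {x : C(T, ℝ) | ∀ t, x t ≤ u t} := by
    simp only [Set.ofPred_forall]
    exact isClosed_iInter fun t => isClosed_le (by fun_prop) continuous_const
  obtain ⟨B, hB, hBA⟩ := exists_measurableSet_eq_preimage_of_isClosed hcl
  have hmem : ∀ x : T → ℝ, Continuous x → (x ∈ B ↔ ∀ t, x t ≤ u t) := fun x hx =>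
    Set.ext_iff.1 hBA ⟨x, hx⟩
  have h := congrArg (fun m => m B) (map_tilted_eq_map_add hX hX0 hXm hXc ν c)
  beta_reduce at h
  rw [Measure.map_apply (measurable_pi_lambda _ fun t => (hXm t).add_const _) hB,
    Measure.map_apply (measurable_pi_lambda _ hXm) hB] at h
  have e1 : {ω | ∀ t, X t ω + c * ∫ s, covFun X P t s ∂ν ≤ u t} =
      (fun ω t => X t ω + c * ∫ s, covFun X P t s ∂ν) ⁻¹' B := by
    ext ω
    exact (hmem _ ((hXc ω).add (continuous_const.mul (continuous_covOp hX hX0 hXc ν)))).symm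
  have e2 : {ω | ∀ t, X t ω ≤ u t} = (fun ω t => X t ω) ⁻¹' B := by
    ext ω
    exact (hmem _ (hXc ω)).symm
  rw [e1, e2, h]

/-- The lower bound: after the Cameron--Martin change of measure it is enough to keep the paths
lying between `v` and `u`, on which the density is at least
`exp (c ∫ v dν - c² / 2 ∫∫ R dν dν)`. -/
theorem exp_mul_measure_le_measure_add_le (hX : IsGaussianProcess X P)
    (hX0 : ∀ t, ∫ ω, X t ω ∂P = 0) (hXm : ∀ t, Measurable (X t))
    (hXc : ∀ ω, Continuous fun t => X t ω) (ν : Measure T) [IsFiniteMeasure ν] (u : T → ℝ)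
    {v : T → ℝ} (hv : Continuous v) {c : ℝ} (hc : 0 ≤ c) :
    ENNReal.ofReal (Real.exp (c * (∫ t, v t ∂ν) -
        c ^ 2 / 2 * ∫ t, ∫ s, covFun X P t s ∂ν ∂ν)) *
      P {ω | ∀ t, v t ≤ X t ω ∧ X t ω ≤ u t} ≤
    P {ω | ∀ t, X t ω + c * ∫ s, covFun X P t s ∂ν ≤ u t} := by
  have := hX.isProbabilityMeasure
  have hexp := integrable_exp_pathIntegral hX hX0 hXc ν c
  rw [measure_add_le_eq_tilted hX hX0 hXm hXc]
  refine le_trans ?_ (measure_mono (s := {ω | ∀ t, v t ≤ X t ω ∧ X t ω ≤ u t})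
    fun ω hω t => (hω t).2)
  rw [tilted_apply, mgf_pathIntegral hX hX0 hXc ν c, ← setLIntegral_const]
  refine setLIntegral_mono_ae ?_ (ae_of_all _ fun ω hω => ?_)
  · exact (hexp.1.aemeasurable.div_const _).ennreal_ofReal.restrict
  · rw [← Real.exp_sub]
    refine ENNReal.ofReal_le_ofReal (Real.exp_le_exp.2 ?_)
    have : ∫ t, v t ∂ν ≤ ∫ t, X t ω ∂ν :=
      integral_mono (integrable_of_continuous ν hv) (integrable_of_continuous ν (hXc ω))
        fun t => (hω t).1
    nlinarith [mul_le_mul_of_nonneg_left this hc]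

/-- The upper bound: integrating the non-crossing inequality against `ν` bounds the centered
Gaussian variable `∫ X_t ν(dt)` from above, and Chernoff's bound applies. -/
theorem measureReal_add_le_le_exp (hX : IsGaussianProcess X P)
    (hX0 : ∀ t, ∫ ω, X t ω ∂P = 0) (hXc : ∀ ω, Continuous fun t => X t ω)
    (ν : Measure T) [IsFiniteMeasure ν] {f u : T → ℝ} (hf : Integrable f ν)
    (hu : Integrable u ν) (hfν : ∫ t, ∫ s, covFun X P t s ∂ν ∂ν ≤ ∫ t, f t ∂ν)
    {c : ℝ} (hc : 0 ≤ c) :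
    P.real {ω | ∀ t, X t ω + c * f t ≤ u t} ≤
      Real.exp (c * (∫ t, u t ∂ν) - c ^ 2 / 2 * ∫ t, ∫ s, covFun X P t s ∂ν ∂ν) := by
  have := hX.isProbabilityMeasure
  set V := ∫ t, ∫ s, covFun X P t s ∂ν ∂ν
  have hsub : {ω | ∀ t, X t ω + c * f t ≤ u t} ⊆
      {ω | ∫ t, X t ω ∂ν ≤ (∫ t, u t ∂ν) - c * V} := by
    intro ω hω
    have hXi := integrable_of_continuous ν (hXc ω)
    have h := integral_mono (hXi.add (hf.const_mul c)) hu hω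
    rw [integral_add' hXi (hf.const_mul c), integral_const_mul] at h
    have := mul_le_mul_of_nonneg_left hfν hc
    simp only [Set.mem_ofPred_eq]
    linarith
  have hch := measure_le_le_exp_mul_mgf (μ := P) (X := fun ω => ∫ t, X t ω ∂ν)
    ((∫ t, u t ∂ν) - c * V) (neg_nonpos.2 hc) (integrable_exp_pathIntegral hX hX0 hXc ν (-c))
  refine (measureReal_mono hsub).trans (hch.trans_eq ?_)
  rw [mgf, mgf_pathIntegral hX hX0 hXc ν (-c), ← Real.exp_add]
  congr 1
  ring

/-- The logarithmic asymptotics of non-crossing probabilities for a process with measurable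
coordinates and continuous paths, the extremal measure being a finite measure `ν` on the whole
space. -/
theorem log_measureReal_add_le_asymptotics (hX : IsGaussianProcess X P)
    (hX0 : ∀ t, ∫ ω, X t ω ∂P = 0) (hXm : ∀ t, Measurable (X t))
    (hXc : ∀ ω, Continuous fun t => X t ω) (ν : Measure T) [IsFiniteMeasure ν] {f u : T → ℝ}
    (hf : Integrable f ν) (hu : Integrable u ν)
    (hfν : ∫ t, ∫ s, covFun X P t s ∂ν ∂ν ≤ ∫ t, f t ∂ν)
    (hfle : ∀ t, f t ≤ ∫ s, covFun X P t s ∂ν)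
    {un : ℕ → T → ℝ} (hunc : ∀ n, Continuous (un n))
    (hun : ∀ᵐ t ∂ν, Monotone (fun n => un n t) ∧ Tendsto (fun n => un n t) atTop (𝓝 (u t)))
    (hpos : ∀ n, 0 < P {ω | ∀ t, un n t ≤ X t ω ∧ X t ω ≤ u t}) :
    (∀ᶠ c : ℝ in atTop, 0 < P.real {ω | ∀ t, X t ω + c * f t ≤ u t}) ∧
    (fun c : ℝ => Real.log (P.real {ω | ∀ t, X t ω + c * f t ≤ u t}) -
        (-(c ^ 2 / 2) * (∫ t, ∫ s, covFun X P t s ∂ν ∂ν) + c * ∫ t, u t ∂ν))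
      =o[atTop] (fun c : ℝ => c) := by
  have := hX.isProbabilityMeasure
  set V := ∫ t, ∫ s, covFun X P t s ∂ν ∂ν
  set Θ := ∫ t, u t ∂ν
  let p : ℕ → ℝ := fun n => P.real {ω | ∀ t, un n t ≤ X t ω ∧ X t ω ≤ u t}
  have hp : ∀ n, 0 < p n := fun n => ENNReal.toReal_pos (hpos n).ne' (measure_ne_top _ _)
  have hlow : ∀ n (c : ℝ), 0 ≤ c →
      Real.exp (c * (∫ t, un n t ∂ν) - c ^ 2 / 2 * V) * p n ≤
        P.real {ω | ∀ t, X t ω + c * f t ≤ u t} := by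
    intro n c hc
    have h := (exp_mul_measure_le_measure_add_le hX hX0 hXm hXc ν u (hunc n) hc).trans
      (measure_mono (t := {ω | ∀ t, X t ω + c * f t ≤ u t}) fun ω hω t => by
        have := mul_le_mul_of_nonneg_left (hfle t) hc
        linarith [hω t])
    have h' := ENNReal.toReal_mono (measure_ne_top _ _) h
    rwa [ENNReal.toReal_mul, ENNReal.toReal_ofReal (Real.exp_pos _).le] at h'
  have hprob : ∀ c : ℝ, 0 ≤ c → 0 < P.real {ω | ∀ t, X t ω + c * f t ≤ u t} := fun c hc =>
    (mul_pos (Real.exp_pos _) (hp 0)).trans_le (hlow 0 c hc)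
  have hlim : Tendsto (fun n => ∫ t, un n t ∂ν) atTop (𝓝 Θ) :=
    integral_tendsto_of_tendsto_of_monotone (fun n => integrable_of_continuous ν (hunc n)) hu
      (hun.mono fun t h => h.1) (hun.mono fun t h => h.2)
  refine ⟨(eventually_ge_atTop 0).mono hprob, Asymptotics.isLittleO_iff.2 fun ε hε => ?_⟩
  -- `un n` is chosen with integral within `ε / 2` of `Θ`; the constant `log (p n)` is then
  -- absorbed by the other `c * ε / 2`.
  obtain ⟨n, hn⟩ := (hlim.eventually (lt_mem_nhds (sub_lt_self Θ (half_pos hε)))).exists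
  filter_upwards [eventually_ge_atTop 0, eventually_ge_atTop (-Real.log (p n) / (ε / 2))]
    with c hc hcn
  have hup := Real.log_le_log (hprob c hc) (measureReal_add_le_le_exp hX hX0 hXc ν hf hu hfν hc)
  rw [Real.log_exp] at hup
  have hlo := Real.log_le_log (mul_pos (Real.exp_pos _) (hp n)) (hlow n c hc)
  rw [Real.log_mul (Real.exp_pos _).ne' (hp n).ne', Real.log_exp] at hlo
  rw [div_le_iff₀ (half_pos hε)] at hcn
  have h1 := mul_le_mul_of_nonneg_left hn.le hc
  rw [Real.norm_eq_abs, Real.norm_eq_abs, abs_of_nonneg hc, abs_le]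
  constructor
  · linarith
  · linarith [mul_nonneg hε.le hc]

end Asymptotics

/-! ### The reproducing kernel Hilbert space and the zero set -/

section Transfer

variable {T Ω : Type*} [MeasurableSpace Ω] {P : Measure Ω} {X : T → Ω → ℝ}

/-- Elements of the reproducing kernel Hilbert space are continuous when the covariance is. -/
theorem continuous_of_mem_rkhs [TopologicalSpace T] (hX : IsGaussianProcess X P)
    (hR : Continuous fun p : T × T => covFun X P p.1 p.2) {f : T → ℝ} (hf : f ∈ rkhs hX) :
    Continuous f := by
  have : Fact (covKernel X P).PosSemidef := ⟨covKernel_posSemidef hX⟩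
  obtain ⟨g, rfl⟩ := hf
  let k : T → RKHS.OfKernel (covKernel X P) := fun t =>
    RKHS.kerFun (RKHS.OfKernel (covKernel X P)) t (1 : ℝ)
  have hk : ∀ t s, inner ℝ (k t) (k s) = covFun X P t s := by
    intro t s
    simp only [k]
    rw [RKHS.kerFun_inner, RKHS.kerFun_apply, RKHS.OfKernel.kernel_ofKernel]
    simp [covKernel]
  have hkc : Continuous k := by
    refine continuous_iff_continuousAt.2 fun t => ?_
    rw [ContinuousAt, tendsto_iff_norm_sub_tendsto_zero]
    have hsq : ∀ s, ‖k s - k t‖ =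
        Real.sqrt (covFun X P s s - 2 * covFun X P s t + covFun X P t t) := by
      intro s
      rw [← Real.sqrt_sq (norm_nonneg (k s - k t)), norm_sub_sq_real,
        ← real_inner_self_eq_norm_sq, ← real_inner_self_eq_norm_sq, hk, hk, hk]
    simp_rw [hsq]
    have h1 : Continuous fun s => covFun X P s s :=
      hR.comp (by fun_prop : Continuous fun s => (s, s))
    have h2 : Continuous fun s => covFun X P s t :=
      hR.comp (by fun_prop : Continuous fun s => (s, t))
    have h3 : Continuous fun s =>
        Real.sqrt (covFun X P s s - 2 * covFun X P s t + covFun X P t t) := by fun_prop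
    have h4 := h3.tendsto t
    rwa [show covFun X P t t - 2 * covFun X P t t + covFun X P t t = 0 by ring,
      Real.sqrt_zero] at h4
  have : (RKHS.coeCLM ℝ : RKHS.OfKernel (covKernel X P) →L[ℝ] T → ℝ).toLinearMap g =
      fun t => inner ℝ (k t) g := by
    funext t
    simp only [k]
    rw [RKHS.kerFun_inner]
    simp
  rw [this]
  fun_prop

/-- The zero set is the zero set of the variance. -/
theorem mem_zeroSet_iff (hX : IsGaussianProcess X P) (t : T) :
    t ∈ zeroSet X P ↔ covFun X P t t = 0 := by
  have h := integral_eq_zero_iff_of_nonneg (μ := P) (f := fun ω => X t ω * X t ω)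
    (fun ω => mul_self_nonneg _) (integrable_mul_process hX t t)
  rw [covFun, h, zeroSet, Set.mem_ofPred_eq]
  exact eventually_congr (ae_of_all _ fun ω => by simp)

end Transfer

end NonCrossing

/-! ### The asymptotic expansion -/

theorem theorem2p7 {T Ω : Type*} [MetricSpace T] [CompactSpace T] [MeasurableSpace T]
    [BorelSpace T] [MeasurableSpace Ω] (P : Measure Ω) [IsProbabilityMeasure P]
    (X : T → Ω → ℝ) (hX : IsGaussianProcess X P) (hX0 : ∀ t, ∫ ω, X t ω ∂P = 0)
    (hXc : ∀ᵐ ω ∂P, Continuous fun t => X t ω)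
    -- (D)
    (hD : Function.Injective (NonCrossing.covOp X P))
    (f : T → ℝ) (hf : f ∈ NonCrossing.rkhs hX)
    (u : T → ℝ) (hu : LowerSemicontinuous u) (hU : NonCrossing.CondU X P u)
    (γ : SignedMeasure (NonCrossing.NonzeroSet X P))
    (hG1 : 0 ≤ γ)
    (hG2 : 0 ≤ NonCrossing.pairing X P (fun t => f t - NonCrossing.covOp X P γ t) γ)
    (hG3 : ∀ t, f t ≤ NonCrossing.covOp X P γ t)
    -- finiteness of the integral of `u` in the expansion
    (huγ : γ.Integrable (fun t : NonCrossing.NonzeroSet X P => u t)) :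
    (∀ᶠ c : ℝ in atTop, 0 < NonCrossing.nonCrossProb X P (c • f) u) ∧
    (fun c : ℝ => Real.log (NonCrossing.nonCrossProb X P (c • f) u) -
        (-(c ^ 2 / 2) * NonCrossing.normHX X P γ ^ 2 + c * NonCrossing.pairing X P u γ))
      =o[atTop] (fun c : ℝ => c) := by
  obtain ⟨m, hm, rfl⟩ : ∃ (m : Measure (NonCrossing.NonzeroSet X P)) (_ : IsFiniteMeasure m),
      γ = m.toSignedMeasure :=
    have h : VectorMeasure.restrict 0 Set.univ ≤ γ.restrict Set.univ := by simpa using hG1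
    ⟨γ.toMeasureOfZeroLE Set.univ MeasurableSet.univ h, inferInstance,
      (γ.toMeasureOfZeroLE_toSignedMeasure h).symm⟩
  obtain ⟨W, hWm, hWc, hWX⟩ :=
    NonCrossing.exists_continuous_modification (fun t => hX.aemeasurable t) hXc
  have hWXt : ∀ t, W t =ᵐ[P] X t := fun t => hWX.mono fun ω h => h t
  have hW : IsGaussianProcess W P := hX.congr fun t => (hWXt t).symm
  have hW0 : ∀ t, ∫ ω, W t ω ∂P = 0 := fun t => by
    rw [integral_congr_ae (hWXt t), hX0 t]
  have hcov : NonCrossing.covFun W P = NonCrossing.covFun X P := by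
    funext t s
    exact integral_congr_ae ((hWXt t).mul (hWXt s))
  have hR := NonCrossing.continuous_covFun hW hW0 hWc
  have hRX := hcov ▸ hR
  have hfc := NonCrossing.continuous_of_mem_rkhs hX hRX hf
  -- `T₁` is open, so that `m` can be treated as a measure on `T`.
  have hzero : MeasurableSet (NonCrossing.zeroSet X P)ᶜ := by
    have : NonCrossing.zeroSet X P = {t | NonCrossing.covFun X P t t = 0} :=
      Set.ext fun t => NonCrossing.mem_zeroSet_iff hX t
    rw [this]
    exact (isClosed_eq (hRX.comp (by fun_prop : Continuous fun t => (t, t)))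
      continuous_const).measurableSet.compl
  have hemb : MeasurableEmbedding (Subtype.val : NonCrossing.NonzeroSet X P → T) :=
    MeasurableEmbedding.subtype_coe hzero
  set ν : Measure T := m.map Subtype.val
  have hint : ∀ g : T → ℝ, ∫ t : NonCrossing.NonzeroSet X P, g t ∂m = ∫ t, g t ∂ν :=
    fun g => (hemb.integral_map g).symm
  have hpair : ∀ g : T → ℝ, NonCrossing.pairing X P g m.toSignedMeasure = ∫ t, g t ∂ν := by
    intro g
    rw [NonCrossing.pairing, VectorMeasure.integral_toSignedMeasure, hint]
  have hop : ∀ t, NonCrossing.covOp X P m.toSignedMeasure t =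
      ∫ s, NonCrossing.covFun W P t s ∂ν := by
    intro t
    rw [NonCrossing.covOp, VectorMeasure.integral_toSignedMeasure,
      hint (fun s => NonCrossing.covFun X P t s), hcov]
  have hnorm : NonCrossing.normHX X P m.toSignedMeasure ^ 2 =
      ∫ t, ∫ s, NonCrossing.covFun W P t s ∂ν ∂ν := by
    have h : NonCrossing.innerHX X P m.toSignedMeasure m.toSignedMeasure =
        ∫ t, ∫ s, NonCrossing.covFun W P t s ∂ν ∂ν := by
      rw [NonCrossing.innerHX, hpair]
      simp_rw [hop]
    rw [NonCrossing.normHX, h,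
      Real.sq_sqrt (NonCrossing.pathIntegral_variance_nonneg hW hW0 hWc ν)]
  have hfi := NonCrossing.integrable_of_continuous ν hfc
  have hfν : ∫ t, ∫ s, NonCrossing.covFun W P t s ∂ν ∂ν ≤ ∫ t, f t ∂ν := by
    rw [hpair] at hG2
    simp_rw [hop] at hG2
    rw [integral_sub hfi (NonCrossing.integrable_of_continuous ν
      (NonCrossing.continuous_covOp hW hW0 hWc ν))] at hG2
    linarith
  have hui : Integrable u ν := by
    rw [VectorMeasure.Integrable, Measure.variation_toSignedMeasure] at huγ
    exact hemb.integrable_map_iff.2 huγ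
  obtain ⟨un, hunc, hun, hpos⟩ := hU
  have hunν : ∀ᵐ t ∂ν, Monotone (fun n => un n t) ∧
      Tendsto (fun n => un n t) atTop (𝓝 (u t)) :=
    hemb.ae_map_iff.2 (ae_of_all _ fun t => hun t t.2)
  have hposW : ∀ n, 0 < P {ω | ∀ t, un n t ≤ W t ω ∧ W t ω ≤ u t} := by
    intro n
    refine (hpos n).trans_eq (measure_congr ?_)
    filter_upwards [hWX] with ω hω
    exact propext (forall_congr' fun t => by rw [hω t])
  have hprob : ∀ c : ℝ, NonCrossing.nonCrossProb X P (c • f) u =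
      P.real {ω | ∀ t, W t ω + c * f t ≤ u t} := by
    intro c
    refine measureReal_congr ?_
    filter_upwards [hWX] with ω hω
    exact propext (forall_congr' fun t => by rw [hω t]; rfl)
  simp_rw [hprob, hnorm, hpair]
  exact NonCrossing.log_measureReal_add_le_asymptotics hW hW0 hWm hWc ν hfi hui hfν
    (fun t => (hG3 t).trans_eq (hop t)) hunc hunν hposW
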